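/- Let $n\ge 1$. Let $A_s(n,\mathbb C)$ be the unital $\mathbb C$-algebra presented by generators $u_{ij}$, $1\le i,j\le n$, and the relations $$u_{ki}u_{kj}=\delta_{ij}u_{ki},\qquad \sum_{k=1}^n u_{ik}=1,\qquad u_{ik}u_{jk}=\delta_{ij}u_{ik},\qquad \sum_{k=1}^n u_{ki}=1 ,$$ with the Hopf $*$-algebra structure $$\Delta(u_{ij})=\sum_{k=1}^n u_{ik}\otimes u_{kj},\qquad \varepsilon(u_{ij})=\delta_{ij},\qquad S(u_{ij})=u_{ji},\qquad u_{ij}^*=u_{ij}.$$ Let $e_1,\dots,e_n$ be the canonical basis of the $*$-algebra $\mathbb C^n$ (with pointwise operations), and let $\alpha:\mathbb C^n\to\mathbb C^n\otimes A_s(n,\mathbb C)$ be the linear map given by $\alpha(e_i)=\sum_{k=1}^n e_k\otimes u_{ki}$. A CQG algebra is a Hopf $*$-algebra over $\mathbb C$ all of whose finite-dimensional (right) comodules are equivalent to unitary ones. A coaction of a CQG algebra $H$ on $\mathbb C^n$ is a unital $*$-algebra map $\beta:\mathbb C^n\to\mathbb C^n\otimes H$ which makes $\mathbb C^n$ into a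 right $H$-comodule. **Theorem.** $A_s(n,\mathbb C)$ is the universal CQG algebra coacting on $\mathbb C^n$. That is, $A_s(n,\mathbb C)$ is a CQG algebra, $\alpha$ is a coaction of $A_s(n,\mathbb C)$ on $\mathbb C^n$, and for every CQG algebra $H$ and every coaction $\beta:\mathbb C^n\to\mathbb C^n\otimes H$ there is a unique bialgebra map $f:A_s(n,\mathbb C)\to H$ such that $(\mathrm{id}_{\mathbb C^n}\otimes f)\circ\alpha=\beta$; moreover $f$ is a $*$-map. -/

import Mathlib

open scoped TensorProduct

noncomputable section

/-! ### Comodules, coactions and CQG algebras -/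

/-- `ρ : V → V ⊗ C` is a right comodule structure on `V` over the coalgebra `C`. -/
structure IsComodule {K V C : Type*} [Field K] [AddCommGroup V] [Module K V]
    [AddCommGroup C] [Module K C] [Coalgebra K C] (ρ : V →ₗ[K] V ⊗[K] C) : Prop where
  coassoc : (TensorProduct.assoc K V C C).toLinearMap ∘ₗ ρ.rTensor C ∘ₗ ρ =
    (Coalgebra.comul (R := K) (A := C)).lTensor V ∘ₗ ρ
  counit : (TensorProduct.rid K V).toLinearMap ∘ₗ
    (Coalgebra.counit (R := K) (A := C)).lTensor V ∘ₗ ρ = LinearMap.id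

/-- A coaction of the bialgebra `B` on the algebra `A`: an algebra map `β : A → A ⊗ B` which makes
`A` into a right `B`-comodule. -/
def IsCoaction {K A B : Type*} [Field K] [Ring A] [Algebra K A] [Ring B] [Bialgebra K B]
    (β : A →ₐ[K] A ⊗[K] B) : Prop :=
  IsComodule β.toLinearMap

/-- A Hopf algebra over `ℂ` which is a `*`-algebra is a Hopf `*`-algebra if its comultiplication
and its counit are `*`-maps; on `H ⊗ H` the involution is `(a ⊗ b)* = a* ⊗ b*`. -/
structure IsHopfStarAlgebra (H : Type*) [Ring H] [HopfAlgebra ℂ H] [StarRing H]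
    [StarModule ℂ H] : Prop where
  comul_star : ∀ a : H, Coalgebra.comul (R := ℂ) (star a) = star (Coalgebra.comul (R := ℂ) a)
  counit_star : ∀ a : H, Coalgebra.counit (R := ℂ) (star a) = star (Coalgebra.counit (R := ℂ) a)

/-- A comodule structure on the Hilbert space `ℂ^m` is unitary if its matrix `u` of coefficients in
the standard orthonormal basis is unitary: `u u* = u* u = 1`, where `(u*)_{ij} = (u_{ji})*`. Up to
the choice of an orthonormal basis, every finite dimensional Hilbert space is of this form. -/
def IsUnitaryComodule {H : Type*} [Ring H] [HopfAlgebra ℂ H] [StarRing H] {m : ℕ}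
    (σ : EuclideanSpace ℂ (Fin m) →ₗ[ℂ] EuclideanSpace ℂ (Fin m) ⊗[ℂ] H) : Prop :=
  IsComodule σ ∧ ∃ u : Fin m → Fin m → H, Matrix.of u ∈ unitary (Matrix (Fin m) (Fin m) H) ∧
    ∀ j, σ (EuclideanSpace.single j 1) = ∑ i, EuclideanSpace.single i 1 ⊗ₜ[ℂ] u i j

/-- CQG algebras: Hopf `*`-algebras all of whose finite dimensional comodules are equivalent
(that is, isomorphic as comodules) to unitary ones. Every finite dimensional space has a copy in
`Type`, so that it is enough to let `V` range over `Type`. -/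
structure IsCQGAlgebra (H : Type*) [Ring H] [HopfAlgebra ℂ H] [StarRing H]
    [StarModule ℂ H] : Prop extends IsHopfStarAlgebra H where
  unitarizable : ∀ (V : Type) [AddCommGroup V] [Module ℂ V] [FiniteDimensional ℂ V]
    (ρ : V →ₗ[ℂ] V ⊗[ℂ] H), IsComodule ρ →
      ∃ (m : ℕ) (σ : EuclideanSpace ℂ (Fin m) →ₗ[ℂ] EuclideanSpace ℂ (Fin m) ⊗[ℂ] H)
        (e : V ≃ₗ[ℂ] EuclideanSpace ℂ (Fin m)),
        IsUnitaryComodule σ ∧ e.toLinearMap.rTensor H ∘ₗ ρ = σ ∘ₗ e.toLinearMap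

/-- A coaction of a Hopf `*`-algebra `H` on a `*`-algebra `A`: a coaction on the algebra `A` which
is moreover a `*`-map; on `A ⊗ H` the involution is `(a ⊗ x)* = a* ⊗ x*`. -/
structure IsStarCoaction {A H : Type*} [Ring A] [Algebra ℂ A] [StarRing A] [StarModule ℂ A]
    [Ring H] [HopfAlgebra ℂ H] [StarRing H] [StarModule ℂ H]
    (β : A →ₐ[ℂ] A ⊗[ℂ] H) : Prop where
  isCoaction : IsCoaction β
  map_star : ∀ a, β (star a) = star (β a)

/-! ### Magic matrices and the algebra `A_s(n, K)` -/

/-- The defining relations of magic matrices. -/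
structure IsMagic {A : Type*} [Ring A] {n : ℕ} (x : Fin n → Fin n → A) : Prop where
  row_mul : ∀ i j k, x k i * x k j = if i = j then x k i else 0
  row_sum : ∀ i, ∑ k, x i k = 1
  col_mul : ∀ i j k, x i k * x j k = if i = j then x i k else 0
  col_sum : ∀ i, ∑ k, x k i = 1

namespace QuantumPerm

/-- The relations that make the matrix of the free generators a magic matrix. -/
inductive Rel (K : Type*) [Field K] (n : ℕ) :
    FreeAlgebra K (Fin n × Fin n) → FreeAlgebra K (Fin n × Fin n) → Prop
  | row_mul (i j k : Fin n) : Rel K n (FreeAlgebra.ι K (k, i) * FreeAlgebra.ι K (k, j))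
      (if i = j then FreeAlgebra.ι K (k, i) else 0)
  | row_sum (i : Fin n) : Rel K n (∑ k, FreeAlgebra.ι K (i, k)) 1
  | col_mul (i j k : Fin n) : Rel K n (FreeAlgebra.ι K (i, k) * FreeAlgebra.ι K (j, k))
      (if i = j then FreeAlgebra.ι K (i, k) else 0)
  | col_sum (i : Fin n) : Rel K n (∑ k, FreeAlgebra.ι K (k, i)) 1

end QuantumPerm

/-- The algebra `A_s(n, K)`, presented by generators `u i j` subject to the relations making
`u` a magic matrix. -/
def QuantumPerm (K : Type*) [Field K] (n : ℕ) : Type _ := RingQuot (QuantumPerm.Rel K n)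

namespace QuantumPerm

section Algebra

variable (K : Type*) [Field K] (n : ℕ)

instance : Ring (QuantumPerm K n) := inferInstanceAs (Ring (RingQuot (Rel K n)))

instance : Algebra K (QuantumPerm K n) := inferInstanceAs (Algebra K (RingQuot (Rel K n)))

/-- The quotient map from the free algebra. -/
def mk : FreeAlgebra K (Fin n × Fin n) →ₐ[K] QuantumPerm K n := RingQuot.mkAlgHom K (Rel K n)

/-- The generating matrix of `A_s(n, K)`. -/
def u : Fin n → Fin n → QuantumPerm K n := fun i j => mk K n (FreeAlgebra.ι K (i, j))

theorem isMagic_u : IsMagic (u K n) where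
  row_mul i j k := by
    have h : mk K n _ = mk K n _ := RingQuot.mkAlgHom_rel K (Rel.row_mul (K := K) i j k)
    rw [map_mul] at h
    refine h.trans ?_; split_ifs <;> simp [u]
  row_sum i := by
    have h : mk K n _ = mk K n _ := RingQuot.mkAlgHom_rel K (Rel.row_sum (K := K) i)
    rwa [map_sum, map_one] at h
  col_mul i j k := by
    have h : mk K n _ = mk K n _ := RingQuot.mkAlgHom_rel K (Rel.col_mul (K := K) i j k)
    rw [map_mul] at h
    refine h.trans ?_; split_ifs <;> simp [u]
  col_sum i := by
    have h : mk K n _ = mk K n _ := RingQuot.mkAlgHom_rel K (Rel.col_sum (K := K) i)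
    rwa [map_sum, map_one] at h

variable {K n}

/-- The universal property of `A_s(n, K)` as an algebra. -/
def lift {A : Type*} [Ring A] [Algebra K A] (x : Fin n → Fin n → A) (hx : IsMagic x) :
    QuantumPerm K n →ₐ[K] A :=
  RingQuot.liftAlgHom K ⟨FreeAlgebra.lift K (fun p => x p.1 p.2), by
    intro a b h
    cases h with
    | row_mul i j k =>
      simp only [map_mul, FreeAlgebra.lift_ι_apply, hx.row_mul]
      split_ifs <;> simp
    | row_sum i => simpa using hx.row_sum i
    | col_mul i j k =>
      simp only [map_mul, FreeAlgebra.lift_ι_apply, hx.col_mul]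
      split_ifs <;> simp
    | col_sum i => simpa using hx.col_sum i⟩

@[simp]
theorem lift_u {A : Type*} [Ring A] [Algebra K A] (x : Fin n → Fin n → A) (hx : IsMagic x)
    (i j : Fin n) : lift x hx (u K n i j) = x i j := by
  have h := RingQuot.liftAlgHom_mkAlgHom_apply (S := K) (FreeAlgebra.lift K (fun p => x p.1 p.2))
    (s := Rel K n) (by
      intro a b h
      cases h with
      | row_mul i j k =>
        simp only [map_mul, FreeAlgebra.lift_ι_apply, hx.row_mul]
        split_ifs <;> simp
      | row_sum i => simpa using hx.row_sum i
      | col_mul i j k =>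
        simp only [map_mul, FreeAlgebra.lift_ι_apply, hx.col_mul]
        split_ifs <;> simp
      | col_sum i => simpa using hx.col_sum i) (FreeAlgebra.ι K (i, j))
  rw [FreeAlgebra.lift_ι_apply] at h
  exact h

theorem algHom_ext {A : Type*} [Ring A] [Algebra K A] {f g : QuantumPerm K n →ₐ[K] A}
    (h : ∀ i j, f (u K n i j) = g (u K n i j)) : f = g := by
  apply RingQuot.ringQuot_ext' K
  apply FreeAlgebra.hom_ext
  funext p
  exact h p.1 p.2

theorem induction {P : QuantumPerm K n → Prop} (hu : ∀ i j, P (u K n i j))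
    (hK : ∀ c : K, P (algebraMap K _ c)) (hadd : ∀ a b, P a → P b → P (a + b))
    (hmul : ∀ a b, P a → P b → P (a * b)) (a : QuantumPerm K n) : P a := by
  obtain ⟨b, rfl⟩ := RingQuot.mkAlgHom_surjective K (Rel K n) a
  change P (mk K n b)
  induction b using FreeAlgebra.induction with
  | grade0 r => rw [AlgHom.commutes]; exact hK r
  | grade1 p => exact hu p.1 p.2
  | mul a b ha hb => rw [map_mul]; exact hmul _ _ ha hb
  | add a b ha hb => rw [map_add]; exact hadd _ _ ha hb

end Algebra

end QuantumPerm

/-! ### The Hopf algebra structure of `A_s(n, K)` -/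

theorem IsMagic.tmul {K A B : Type*} [Field K] [Ring A] [Algebra K A] [Ring B] [Algebra K B]
    {n : ℕ} {x : Fin n → Fin n → A} {y : Fin n → Fin n → B}
    (hx : IsMagic x) (hy : IsMagic y) :
    IsMagic (A := A ⊗[K] B) (fun i j => ∑ k, x i k ⊗ₜ[K] y k j) where
  row_mul i j k := by
    simp only [Finset.sum_mul_sum, Algebra.TensorProduct.tmul_mul_tmul, hx.row_mul,
      TensorProduct.ite_tmul, Finset.sum_ite_eq, Finset.mem_univ, if_true,
      hy.row_mul]
    split_ifs <;> simp
  row_sum i := by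
    rw [Finset.sum_comm]
    simp only [← TensorProduct.tmul_sum, hy.row_sum]
    rw [← TensorProduct.sum_tmul, hx.row_sum, Algebra.TensorProduct.one_def]
  col_mul i j k := by
    simp only [Finset.sum_mul_sum, Algebra.TensorProduct.tmul_mul_tmul, hy.col_mul,
      TensorProduct.tmul_ite, Finset.sum_ite_eq, Finset.mem_univ, if_true,
      hx.col_mul]
    split_ifs <;> simp
  col_sum i := by
    rw [Finset.sum_comm]
    simp only [← TensorProduct.sum_tmul, hx.col_sum]
    rw [← TensorProduct.tmul_sum, hy.col_sum, Algebra.TensorProduct.one_def]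

theorem isMagic_one {A : Type*} [Ring A] {n : ℕ} :
    IsMagic (fun i j : Fin n => if i = j then (1 : A) else 0) where
  row_mul i j k := by
    by_cases h : i = j
    · subst h; by_cases h' : k = i <;> simp [h']
    · by_cases h' : k = i
      · subst h'; simp [h]
      · simp [h, h']
  row_sum i := by simp
  col_mul i j k := by
    by_cases h : i = j
    · subst h; by_cases h' : i = k <;> simp [h']
    · by_cases h' : i = k
      · subst h'; simp [h, Ne.symm h]
      · simp [h, h']
  col_sum i := by simp

theorem IsMagic.op_transpose {A : Type*} [Ring A] {n : ℕ} {x : Fin n → Fin n → A}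
    (hx : IsMagic x) : IsMagic (fun i j => MulOpposite.op (x j i)) where
  row_mul i j k := by
    rw [← MulOpposite.op_mul, hx.col_mul]
    by_cases h : i = j
    · subst h; simp
    · simp [h, Ne.symm h]
  row_sum i := by
    rw [← Finset.op_sum, hx.col_sum, MulOpposite.op_one]
  col_mul i j k := by
    rw [← MulOpposite.op_mul, hx.row_mul]
    by_cases h : i = j
    · subst h; simp
    · simp [h, Ne.symm h]
  col_sum i := by
    rw [← Finset.op_sum, hx.row_sum, MulOpposite.op_one]

theorem IsMagic.op {A : Type*} [Ring A] {n : ℕ} {x : Fin n → Fin n → A}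
    (hx : IsMagic x) : IsMagic (fun i j => MulOpposite.op (x i j)) where
  row_mul i j k := by
    rw [← MulOpposite.op_mul, hx.row_mul]
    by_cases h : i = j
    · subst h; simp
    · simp [h, Ne.symm h]
  row_sum i := by
    rw [← Finset.op_sum, hx.row_sum, MulOpposite.op_one]
  col_mul i j k := by
    rw [← MulOpposite.op_mul, hx.col_mul]
    by_cases h : i = j
    · subst h; simp
    · simp [h, Ne.symm h]
  col_sum i := by
    rw [← Finset.op_sum, hx.col_sum, MulOpposite.op_one]

namespace QuantumPerm

section Hopf

variable (K : Type*) [Field K] (n : ℕ)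

/-- `Δ(u i j) = ∑ k, u i k ⊗ u k j`. -/
def comulHom : QuantumPerm K n →ₐ[K] QuantumPerm K n ⊗[K] QuantumPerm K n :=
  lift (fun i j => ∑ k, u K n i k ⊗ₜ[K] u K n k j) ((isMagic_u K n).tmul (isMagic_u K n))

/-- `ε(u i j) = δ i j`. -/
def counitHom : QuantumPerm K n →ₐ[K] K :=
  lift (fun i j => if i = j then 1 else 0) isMagic_one

/-- `S(u i j) = u j i`, as an algebra map to the opposite algebra. -/
def antipodeHom : QuantumPerm K n →ₐ[K] (QuantumPerm K n)ᵐᵒᵖ :=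
  lift (fun i j => MulOpposite.op (u K n j i)) (isMagic_u K n).op_transpose

instance : Bialgebra K (QuantumPerm K n) :=
  Bialgebra.ofAlgHom (comulHom K n) (counitHom K n)
    (by
      apply algHom_ext
      intro i j
      simp only [comulHom, AlgHom.comp_apply, lift_u, map_sum, Algebra.TensorProduct.map_tmul,
        AlgHom.id_apply, TensorProduct.sum_tmul, TensorProduct.tmul_sum]
      rw [Finset.sum_comm]
      rfl)
    (by
      apply algHom_ext
      intro i j
      simp [comulHom, counitHom, AlgHom.comp_apply, TensorProduct.ite_tmul])
    (by
      apply algHom_ext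
      intro i j
      simp [comulHom, counitHom, AlgHom.comp_apply, TensorProduct.tmul_ite])

instance : HopfAlgebraStruct K (QuantumPerm K n) where
  antipode := (MulOpposite.opLinearEquiv K).symm.toLinearMap ∘ₗ (antipodeHom K n).toLinearMap

@[simp]
theorem comul_u (i j : Fin n) :
    Coalgebra.comul (R := K) (u K n i j) = ∑ k, u K n i k ⊗ₜ[K] u K n k j :=
  lift_u _ _ i j

@[simp]
theorem counit_u (i j : Fin n) :
    Coalgebra.counit (R := K) (u K n i j) = if i = j then 1 else 0 :=
  lift_u _ _ i j

@[simp]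
theorem antipode_u (i j : Fin n) :
    HopfAlgebraStruct.antipode K (u K n i j) = u K n j i := by
  change MulOpposite.unop (antipodeHom K n (u K n i j)) = _
  rw [antipodeHom, lift_u, MulOpposite.unop_op]

theorem antipode_one' : HopfAlgebraStruct.antipode K (1 : QuantumPerm K n) = 1 := by
  change MulOpposite.unop (antipodeHom K n 1) = _
  rw [map_one, MulOpposite.unop_one]

theorem antipode_mul' (a b : QuantumPerm K n) :
    HopfAlgebraStruct.antipode K (a * b) =
      HopfAlgebraStruct.antipode K b * HopfAlgebraStruct.antipode K a := by
  change MulOpposite.unop (antipodeHom K n (a * b)) = _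
  rw [map_mul, MulOpposite.unop_mul]
  rfl

variable {K n} in
theorem antipode_left (a : QuantumPerm K n) :
    LinearMap.mul' K _ ((HopfAlgebraStruct.antipode K).rTensor _ (Coalgebra.comul (R := K) a)) =
      algebraMap K (QuantumPerm K n) (Coalgebra.counit a) := by
  have key : ∀ (z : QuantumPerm K n ⊗[K] QuantumPerm K n) (c : K),
      LinearMap.mul' K _ ((HopfAlgebraStruct.antipode K).rTensor _ z) = algebraMap K _ c →
      ∀ w, LinearMap.mul' K _ ((HopfAlgebraStruct.antipode K).rTensor _ (z * w)) =
        c • LinearMap.mul' K _ ((HopfAlgebraStruct.antipode K).rTensor (QuantumPerm K n) w) := by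
    intro z c hz w
    induction w with
    | zero => simp
    | add x y hx hy => rw [mul_add, map_add, map_add, hx, hy, map_add, map_add, smul_add]
    | tmul x y =>
      have h2 : LinearMap.mul' K _ ((HopfAlgebraStruct.antipode K).rTensor _ (z * x ⊗ₜ[K] y)) =
          HopfAlgebraStruct.antipode K x *
            LinearMap.mul' K _ ((HopfAlgebraStruct.antipode K).rTensor _ z) * y := by
        clear hz
        induction z with
        | zero => simp
        | add p q hp hq =>
          rw [add_mul, map_add, map_add, hp, hq, map_add, map_add, mul_add, add_mul]
        | tmul p q => simp [antipode_mul', mul_assoc]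
      rw [h2, hz, ← Algebra.commutes, mul_assoc, ← Algebra.smul_def]
      simp
  induction a using QuantumPerm.induction with
  | hu i j =>
    simp only [comul_u, map_sum, LinearMap.rTensor_tmul, antipode_u, LinearMap.mul'_apply,
      (isMagic_u K n).row_mul, counit_u]
    by_cases h : i = j
    · subst h; simp [(isMagic_u K n).col_sum]
    · simp [h]
  | hK c =>
    simp [antipode_one', Algebra.algebraMap_eq_smul_one, Algebra.TensorProduct.one_def]
  | hadd a b ha hb => simp only [map_add, ha, hb]
  | hmul a b ha hb =>
    rw [Bialgebra.comul_mul, key _ _ ha, hb, Bialgebra.counit_mul, map_mul, Algebra.smul_def]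

variable {K n} in
theorem antipode_right (a : QuantumPerm K n) :
    LinearMap.mul' K _ ((HopfAlgebraStruct.antipode K).lTensor _ (Coalgebra.comul (R := K) a)) =
      algebraMap K (QuantumPerm K n) (Coalgebra.counit a) := by
  have key : ∀ (z : QuantumPerm K n ⊗[K] QuantumPerm K n) (c : K),
      LinearMap.mul' K _ ((HopfAlgebraStruct.antipode K).lTensor _ z) = algebraMap K _ c →
      ∀ w, LinearMap.mul' K _ ((HopfAlgebraStruct.antipode K).lTensor _ (w * z)) =
        c • LinearMap.mul' K _ ((HopfAlgebraStruct.antipode K).lTensor (QuantumPerm K n) w) := by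
    intro z c hz w
    induction w with
    | zero => simp
    | add x y hx hy => rw [add_mul, map_add, map_add, hx, hy, map_add, map_add, smul_add]
    | tmul x y =>
      have h2 : LinearMap.mul' K _ ((HopfAlgebraStruct.antipode K).lTensor _ (x ⊗ₜ[K] y * z)) =
          x * LinearMap.mul' K _ ((HopfAlgebraStruct.antipode K).lTensor _ z) *
            HopfAlgebraStruct.antipode K y := by
        clear hz
        induction z with
        | zero => simp
        | add p q hp hq =>
          rw [mul_add, map_add, map_add, hp, hq, map_add, map_add, mul_add, add_mul]
        | tmul p q => simp [antipode_mul', mul_assoc]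
      rw [h2, hz, ← Algebra.commutes, mul_assoc, ← Algebra.smul_def]
      simp
  induction a using QuantumPerm.induction with
  | hu i j =>
    simp only [comul_u, map_sum, LinearMap.lTensor_tmul, antipode_u, LinearMap.mul'_apply,
      (isMagic_u K n).col_mul, counit_u]
    by_cases h : i = j
    · subst h; simp [(isMagic_u K n).row_sum]
    · simp [h]
  | hK c =>
    simp [antipode_one', Algebra.algebraMap_eq_smul_one, Algebra.TensorProduct.one_def]
  | hadd a b ha hb => simp only [map_add, ha, hb]
  | hmul a b ha hb =>
    rw [Bialgebra.comul_mul, key _ _ hb, ha, Bialgebra.counit_mul, map_mul, Algebra.smul_def,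
      Algebra.commutes]

instance : HopfAlgebra K (QuantumPerm K n) where
  mul_antipode_rTensor_comul := LinearMap.ext antipode_left
  mul_antipode_lTensor_comul := LinearMap.ext antipode_right

end Hopf

/-! ### The involution of `A_s(n, ℂ)` -/

section Star

variable (n : ℕ)

/-- The conjugate of the opposite algebra of `A_s(n, ℂ)`, used only to define the involution. -/
def ConjOp : Type := (QuantumPerm ℂ n)ᵐᵒᵖ

instance : Ring (ConjOp n) := inferInstanceAs (Ring (QuantumPerm ℂ n)ᵐᵒᵖ)

instance : Algebra ℂ (ConjOp n) :=
  RingHom.toAlgebra' ((algebraMap ℂ (QuantumPerm ℂ n)ᵐᵒᵖ).comp (starRingEnd ℂ))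
    (fun c x => Algebra.commutes (A := (QuantumPerm ℂ n)ᵐᵒᵖ) (starRingEnd ℂ c) x)

theorem isMagic_conjOp :
    IsMagic (A := ConjOp n) (fun i j => MulOpposite.op (u ℂ n i j)) :=
  (isMagic_u ℂ n).op

/-- The conjugate linear antimultiplicative map with `(u i j)* = u i j`. -/
def starHom : QuantumPerm ℂ n →ₐ[ℂ] ConjOp n :=
  lift (A := ConjOp n) (fun i j => MulOpposite.op (u ℂ n i j)) (isMagic_conjOp n)

instance : Star (QuantumPerm ℂ n) where
  star a := MulOpposite.unop (starHom n a)

@[simp]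
theorem star_u (i j : Fin n) : star (u ℂ n i j) = u ℂ n i j := by
  change MulOpposite.unop (starHom n (u ℂ n i j)) = _
  exact congrArg MulOpposite.unop (lift_u (A := ConjOp n) _ (isMagic_conjOp n) i j)

variable {n}

theorem star_mul' (a b : QuantumPerm ℂ n) : star (a * b) = star b * star a := by
  change MulOpposite.unop (starHom n (a * b)) = _
  rw [map_mul]
  rfl

theorem star_add' (a b : QuantumPerm ℂ n) : star (a + b) = star a + star b := by
  change MulOpposite.unop (starHom n (a + b)) = _
  rw [map_add]
  rfl

theorem star_algebraMap' (c : ℂ) :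
    star (algebraMap ℂ (QuantumPerm ℂ n) c) = algebraMap ℂ (QuantumPerm ℂ n) (star c) := by
  change MulOpposite.unop (starHom n (algebraMap ℂ (QuantumPerm ℂ n) c)) = _
  rw [AlgHom.commutes]
  rfl

theorem star_star' (a : QuantumPerm ℂ n) : star (star a) = a := by
  induction a using QuantumPerm.induction with
  | hu i j => simp
  | hK c => rw [star_algebraMap', star_algebraMap', star_star]
  | hadd a b ha hb => rw [star_add', star_add', ha, hb]
  | hmul a b ha hb => rw [star_mul', star_mul', ha, hb]

instance : StarRing (QuantumPerm ℂ n) where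
  star_involutive := star_star'
  star_mul := star_mul'
  star_add := star_add'

instance : StarModule ℂ (QuantumPerm ℂ n) where
  star_smul c a := by
    rw [Algebra.smul_def, star_mul, star_algebraMap', ← Algebra.commutes, ← Algebra.smul_def]

end Star

/-! ### The coaction of `A_s(n, K)` on `K^n` -/

section Coaction

variable (K : Type*) [Field K] (n : ℕ)

/-- The linear map `e i ↦ ∑ k, e k ⊗ u k i`. -/
def coactionLin : (Fin n → K) →ₗ[K] (Fin n → K) ⊗[K] QuantumPerm K n :=
  (Pi.basisFun K (Fin n)).constr K (fun i => ∑ k, Pi.single k 1 ⊗ₜ[K] u K n k i)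

theorem coactionLin_single (i : Fin n) :
    coactionLin K n (Pi.single i 1) = ∑ k, Pi.single k 1 ⊗ₜ[K] u K n k i := by
  rw [coactionLin, ← Pi.basisFun_apply, Module.Basis.constr_basis]

theorem coactionLin_one : coactionLin K n 1 = 1 := by
  have h : (1 : Fin n → K) = ∑ i, Pi.single i 1 := (Finset.univ_sum_single (1 : Fin n → K)).symm
  conv_lhs => rw [h]
  rw [map_sum]
  simp only [coactionLin_single]
  rw [Finset.sum_comm]
  simp only [← TensorProduct.tmul_sum, (isMagic_u K n).row_sum]
  rw [← TensorProduct.sum_tmul, ← h, Algebra.TensorProduct.one_def]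

theorem single_mul_single (k l : Fin n) :
    (Pi.single k 1 * Pi.single l 1 : Fin n → K) = if k = l then Pi.single k 1 else 0 := by
  by_cases h : k = l
  · subst h; simp [← Pi.single_mul]
  · simp only [h, if_false]
    ext m
    by_cases hm : m = k
    · subst hm; simp [h]
    · simp [hm]

theorem coactionLin_mul (a b : Fin n → K) :
    coactionLin K n (a * b) = coactionLin K n a * coactionLin K n b := by
  have h : (LinearMap.mul K (Fin n → K)).compr₂ (coactionLin K n) =
      (LinearMap.mul K _).compl₁₂ (coactionLin K n) (coactionLin K n) := by
    refine (Pi.basisFun K (Fin n)).ext fun i => (Pi.basisFun K (Fin n)).ext fun j => ?_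
    simp only [Pi.basisFun_apply, LinearMap.compr₂_apply, LinearMap.mul_apply',
      LinearMap.compl₁₂_apply, coactionLin_single, single_mul_single, Finset.sum_mul_sum,
      Algebra.TensorProduct.tmul_mul_tmul, TensorProduct.ite_tmul,
      Finset.sum_ite_eq, Finset.mem_univ, if_true, (isMagic_u K n).row_mul]
    split_ifs <;> simp [coactionLin_single]
  exact congr($h a b)

/-- The coaction `α : K^n → K^n ⊗ A_s(n, K)`, `α(e i) = ∑ k, e k ⊗ u k i`. -/
def coaction : (Fin n → K) →ₐ[K] (Fin n → K) ⊗[K] QuantumPerm K n :=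
  AlgHom.ofLinearMap (coactionLin K n) (coactionLin_one K n) (coactionLin_mul K n)

@[simp]
theorem coaction_single (i : Fin n) :
    coaction K n (Pi.single i 1) = ∑ k, Pi.single k 1 ⊗ₜ[K] u K n k i :=
  coactionLin_single K n i

end Coaction

end QuantumPerm

end

noncomputable section

open Matrix
open scoped ComplexOrder

/-! ### Matrix corepresentations -/

/-! Everything is done with coefficient matrices. There are two halves.

`A_s(n, ℂ)` is CQG because its generating matrix `u` is a unitary corepresentation whose entries
generate the algebra. Direct sums and tensor products of unitary corepresentations are unitary, so
every element is a combination of coefficients of unitary ones. A comodule with coefficients in the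
span `C` of the entries of a unitary `v` embeds in a power of `C`, and `C` is a quotient of a power
of the comodule of `v`. An invariant inner product thus descends from `v` to `C` and restricts to
the given comodule (`IsCorep.exists_posDef`).

For universality, let `x` be the matrix of a coaction. That the coaction is a unital `*`-algebra map
gives the row relations and self-adjoint entries, but not the column relations. These follow once `S
(x i k) = x k i`. A functional `φ` on `ℂ^n` invariant under the coaction satisfies `φ k • x k i = φ
i • S (x i k)` (`IsCorep.smul_eq_smul_antipode`), so it suffices to have, for each `i`, an invariant
functional with `φ i ≠ 0`. This is where the CQG hypothesis enters: the indicator of the common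
zeros of all invariant functionals is a fixed vector, and pairing with it in an invariant inner
product gives an invariant functional, which forces that set to be empty
(`IsCorep.exists_invariant_functional`). -/

/-- A square matrix `v` over a coalgebra is a corepresentation if `Δ(v i j) = ∑ k, v i k ⊗ v k j`
and `ε(v i j) = δ i j`. -/
structure IsCorep (K : Type*) {C ι : Type*} [Field K] [AddCommGroup C] [Module K C]
    [Coalgebra K C] [Fintype ι] [DecidableEq ι] (v : Matrix ι ι C) : Prop where
  comul : ∀ i j, Coalgebra.comul (R := K) (v i j) = ∑ k, v i k ⊗ₜ[K] v k j
  counit : ∀ i j, Coalgebra.counit (R := K) (v i j) = if i = j then 1 else 0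

section Coefficients

variable {K V C ι : Type*} [Field K] [AddCommGroup V] [Module K V]
  [AddCommGroup C] [Module K C]

/-- The coefficient at the `i`th basis vector of an element of `V ⊗ C`. -/
def tensorCoeff (b : Module.Basis ι K V) (i : ι) : V ⊗[K] C →ₗ[K] C :=
  (TensorProduct.lid K C).toLinearMap ∘ₗ (b.coord i).rTensor C

@[simp]
theorem tensorCoeff_tmul (b : Module.Basis ι K V) (i : ι) (x : V) (c : C) :
    tensorCoeff b i (x ⊗ₜ[K] c) = b.repr x i • c := by
  simp [tensorCoeff]

variable [Fintype ι]

theorem sum_tmul_tensorCoeff (b : Module.Basis ι K V) (z : V ⊗[K] C) :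
    ∑ i, b i ⊗ₜ[K] tensorCoeff b i z = z := by
  induction z with
  | zero => simp
  | add x y hx hy =>
    simp only [map_add, TensorProduct.tmul_add, Finset.sum_add_distrib, hx, hy]
  | tmul x c =>
    simp only [tensorCoeff_tmul, ← TensorProduct.smul_tmul, ← TensorProduct.sum_tmul, b.sum_repr]

theorem tensorCoeff_sum [DecidableEq ι] (b : Module.Basis ι K V) (c : ι → C) (i : ι) :
    tensorCoeff b i (∑ k, b k ⊗ₜ[K] c k) = c i := by
  simp [Finsupp.single_apply]

/-- This is what turns identities in `V ⊗ C` into identities between matrix entries. -/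
theorem sum_basis_tmul_injective (b : Module.Basis ι K V) {c d : ι → C}
    (h : ∑ k, b k ⊗ₜ[K] c k = ∑ k, b k ⊗ₜ[K] d k) : c = d := by
  classical
  funext i
  rw [← tensorCoeff_sum b c i, h, tensorCoeff_sum]

variable [Coalgebra K C] [DecidableEq ι]

/-- The matrix of coefficients of a comodule is a corepresentation. -/
theorem IsComodule.isCorep {ρ : V →ₗ[K] V ⊗[K] C} (h : IsComodule ρ) (b : Module.Basis ι K V)
    {v : Matrix ι ι C} (hv : ∀ j, ρ (b j) = ∑ i, b i ⊗ₜ[K] v i j) : IsCorep K v where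
  comul i j := by
    have := congr($(h.coassoc) (b j))
    simp only [LinearMap.comp_apply, hv, map_sum, LinearMap.rTensor_tmul, LinearMap.lTensor_tmul,
      TensorProduct.sum_tmul, LinearEquiv.coe_coe, TensorProduct.assoc_tmul] at this
    rw [Finset.sum_comm] at this
    simp only [← TensorProduct.tmul_sum] at this
    exact (congrFun (sum_basis_tmul_injective b this) i).symm
  counit i j := by
    have := congr($(h.counit) (b j))
    simp only [LinearMap.comp_apply, hv, map_sum, LinearMap.lTensor_tmul,
      LinearEquiv.coe_coe, TensorProduct.rid_tmul, LinearMap.id_apply] at this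
    have := congr(b.repr $this i)
    simpa [Finsupp.single_apply, eq_comm] using this

/-- A corepresentation is the matrix of coefficients of a comodule. -/
theorem IsCorep.isComodule {v : Matrix ι ι C} (hv : IsCorep K v) (b : Module.Basis ι K V)
    {ρ : V →ₗ[K] V ⊗[K] C} (h : ∀ j, ρ (b j) = ∑ i, b i ⊗ₜ[K] v i j) : IsComodule ρ where
  coassoc := by
    refine b.ext fun j => ?_
    simp only [LinearMap.comp_apply, h, map_sum, LinearMap.rTensor_tmul, LinearMap.lTensor_tmul,
      TensorProduct.sum_tmul, LinearEquiv.coe_coe, TensorProduct.assoc_tmul, hv.comul]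
    rw [Finset.sum_comm]
    simp only [TensorProduct.tmul_sum]
  counit := by
    refine b.ext fun j => ?_
    simp [h, hv.counit]

end Coefficients

/-! ### Corepresentations over a Hopf algebra and the antipode -/

section Hopf

variable {K H ι κ : Type*} [Field K] [Ring H] [HopfAlgebra K H]

/-- The antipode reverses products in `H`, but by linearity scalar matrices pass through it
unchanged. -/
theorem map_antipode_algebraMap_mul [Fintype ι] (B : Matrix κ ι K) {l : Type*} (v : Matrix ι l H) :
    (B.map (algebraMap K H) * v).map (HopfAlgebra.antipode K) =
      B.map (algebraMap K H) * v.map (HopfAlgebra.antipode K) := by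
  ext i j
  simp [Matrix.mul_apply, ← Algebra.smul_def]

theorem map_antipode_mul_algebraMap [Fintype ι] (B : Matrix ι κ K) {l : Type*} (v : Matrix l ι H) :
    (v * B.map (algebraMap K H)).map (HopfAlgebra.antipode K) =
      v.map (HopfAlgebra.antipode K) * B.map (algebraMap K H) := by
  ext i j
  simp [Matrix.mul_apply, ← Algebra.commutes, ← Algebra.smul_def]

theorem map_algebraMap_conjTranspose [StarRing K] [StarRing H] [StarModule K H]
    (B : Matrix ι κ K) : (B.map (algebraMap K H))ᴴ = Bᴴ.map (algebraMap K H) := by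
  ext i j
  simp [algebraMap_star_comm]

variable [Fintype ι] [DecidableEq ι]

theorem IsCorep.antipode_mul {v : Matrix ι ι H} (hv : IsCorep K v) :
    v.map (HopfAlgebra.antipode K) * v = 1 := by
  ext i j
  have := HopfAlgebra.mul_antipode_rTensor_comul_apply (R := K) (v i j)
  rw [hv.comul, hv.counit] at this
  simpa [Matrix.mul_apply, Matrix.one_apply] using this

theorem IsCorep.mul_antipode {v : Matrix ι ι H} (hv : IsCorep K v) :
    v * v.map (HopfAlgebra.antipode K) = 1 := by
  ext i j
  have := HopfAlgebra.mul_antipode_lTensor_comul_apply (R := K) (v i j)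
  rw [hv.comul, hv.counit] at this
  simpa [Matrix.mul_apply, Matrix.one_apply] using this

/-- A unitary corepresentation has antipode equal to its adjoint. -/
theorem IsCorep.map_antipode_eq_conjTranspose [StarRing H] {v : Matrix ι ι H} (hv : IsCorep K v)
    (h : v * vᴴ = 1) : v.map (HopfAlgebra.antipode K) = vᴴ := by
  rw [← Matrix.mul_one (v.map _), ← h, ← Matrix.mul_assoc, hv.antipode_mul, Matrix.one_mul]

end Hopf

/-- A positive definite complex matrix is of the form `Bᴴ * B` with `B` invertible. -/
theorem Matrix.PosDef.exists_conjTranspose_mul_self {ι : Type*} [Fintype ι] [DecidableEq ι]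
    {Q : Matrix ι ι ℂ} (hQ : Q.PosDef) : ∃ B : Matrix ι ι ℂ, IsUnit B ∧ Bᴴ * B = Q := by
  open scoped MatrixOrder in
  have h := hQ.posSemidef.nonneg
  obtain ⟨B, hB⟩ := CStarAlgebra.nonneg_iff_eq_star_mul_self.mp h
  refine ⟨B, ?_, hB.symm⟩
  have := hQ.isUnit
  rw [hB] at this
  rw [Matrix.isUnit_iff_isUnit_det] at this ⊢
  rw [Matrix.det_mul] at this
  exact isUnit_of_mul_isUnit_right this

/-! ### Invariant inner products -/

section Invariant

variable {H ι κ : Type*} [Ring H] [HopfAlgebra ℂ H]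

/-- The span of the entries of a matrix. -/
def entrySpan (v : Matrix κ κ H) : Submodule ℂ H :=
  Submodule.span ℂ (Set.range fun p : κ × κ => v p.1 p.2)

theorem mem_entrySpan (v : Matrix κ κ H) (i j : κ) : v i j ∈ entrySpan v :=
  Submodule.subset_span ⟨(i, j), rfl⟩

/-- Every finite dimensional subspace has a basis with dual functionals defined everywhere. -/
theorem Submodule.exists_dual_family {K V : Type*} [Field K] [AddCommGroup V] [Module K V]
    (C : Submodule K V) [FiniteDimensional K C] :
    ∃ (N : ℕ) (x : Fin N → V) (φ : Fin N → V →ₗ[K] K), (∀ a, x a ∈ C) ∧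
      (∀ a b, φ a (x b) = if a = b then 1 else 0) ∧ ∀ h ∈ C, ∑ a, φ a h • x a = h := by
  let b := Module.finBasis K C
  choose φ hφ using fun a => LinearMap.exists_extend (b.coord a)
  have hφ' : ∀ a (h : C), φ a h = b.repr h a := fun a h => congr($(hφ a) h)
  refine ⟨_, fun a => b a, φ, fun a => (b a).2, fun a c => ?_, fun h hh => ?_⟩
  · rw [hφ']
    simp [Finsupp.single_apply, eq_comm]
  · have := congr(C.subtype $(b.sum_repr ⟨h, hh⟩))
    rw [map_sum] at this
    simpa [← hφ'] using this

variable [Fintype ι] [DecidableEq ι] [Fintype κ] [DecidableEq κ]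

/-- The slice `(φ ⊗ id) ∘ Δ`. -/
def leftSlice (φ : H →ₗ[ℂ] ℂ) : H →ₗ[ℂ] H :=
  (TensorProduct.lid ℂ H).toLinearMap ∘ₗ φ.rTensor H ∘ₗ Coalgebra.comul

/-- Slicing acts on each row of `v` through `v` itself; this is the source of the intertwining
relations `hsT` and `hsM` below. -/
theorem IsCorep.leftSlice_eq_sum {v : Matrix κ κ H} (hv : IsCorep ℂ v) (φ : H →ₗ[ℂ] ℂ) (i j : κ) :
    leftSlice φ (v i j) = ∑ k, φ (v i k) • v k j := by
  simp [leftSlice, hv.comul]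

variable [StarRing H] [StarModule ℂ H]

/-- If the coefficients of a corepresentation `r` lie in the span of those of a unitary
corepresentation, then `r` leaves an inner product invariant. -/
theorem IsCorep.exists_posDef {r : Matrix ι ι H} {v : Matrix κ κ H} (hr : IsCorep ℂ r)
    (hv : IsCorep ℂ v) (hvu : v ∈ unitary (Matrix κ κ H)) (hrv : ∀ i j, r i j ∈ entrySpan v) :
    ∃ Q : Matrix ι ι ℂ, Q.PosDef ∧
      rᴴ * Q.map (algebraMap ℂ H) * r = Q.map (algebraMap ℂ H) := by
  have hv1 : vᴴ * v = 1 := (Unitary.mem_iff.mp hvu).1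
  have hv2 : v * vᴴ = 1 := (Unitary.mem_iff.mp hvu).2
  have : FiniteDimensional ℂ (entrySpan v) := FiniteDimensional.span_of_finite ℂ (Set.finite_range _)
  obtain ⟨N, x, φ, hxC, hφx, hC⟩ := (entrySpan v).exists_dual_family
  -- `s` is the matrix of the comodule `C = entrySpan v` under `Δ`. The columns of `T k` and `M i`
  -- hold the coordinates of row `k` of `v` and row `i` of `r`, so that `T k` and `M i` are comodule
  -- maps into `C`.
  let s : Matrix (Fin N) (Fin N) H := .of fun b a => leftSlice (φ b) (x a)
  let T : κ → Matrix (Fin N) κ ℂ := fun k => .of fun b l => φ b (v k l)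
  let M : ι → Matrix (Fin N) ι ℂ := fun i => .of fun b j => φ b (r i j)
  have hs : ∀ b, ∀ h ∈ entrySpan v, ∑ a, φ a h • s b a = leftSlice (φ b) h := fun b h hh => by
    conv_rhs => rw [← hC h hh]
    simp [s]
  have hsT : ∀ k, s * (T k).map (algebraMap ℂ H) = (T k).map (algebraMap ℂ H) * v := fun k => by
    ext b l
    have := hs b _ (mem_entrySpan v k l)
    rw [hv.leftSlice_eq_sum] at this
    simpa [Matrix.mul_apply, T, ← Algebra.commutes, ← Algebra.smul_def] using this
  have hsM : ∀ i, s * (M i).map (algebraMap ℂ H) = (M i).map (algebraMap ℂ H) * r := fun i => by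
    ext b j
    have := hs b _ (hrv i j)
    rw [hr.leftSlice_eq_sum] at this
    simpa [Matrix.mul_apply, M, ← Algebra.commutes, ← Algebra.smul_def] using this
  have hST : ∀ k, s.map (HopfAlgebra.antipode ℂ) * (T k).map (algebraMap ℂ H) =
      (T k).map (algebraMap ℂ H) * vᴴ := fun k => by
    rw [← map_antipode_mul_algebraMap, hsT, map_antipode_algebraMap_mul,
      hv.map_antipode_eq_conjTranspose hv2]
  -- The `T k` are jointly onto `C`, since the entries of `v` span it; hence `P` is positive
  -- definite. Its inverse is the quotient inner product on `C`.
  let P : Matrix (Fin N) (Fin N) ℂ := ∑ k, T k * (T k)ᴴ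
  have hP : P.PosDef := by
    let T' : Matrix (Fin N) (κ × κ) ℂ := 
      .of fun b p => φ b (v p.1 p.2)
    have hPT : P = T' * T'ᴴ := by
      ext a b
      simp [P, T, T', Matrix.sum_apply, Matrix.mul_apply, Fintype.sum_prod_type]
    rw [hPT]
    refine Matrix.PosDef.mul_conjTranspose_self _ ?_
    rw [← Matrix.coe_vecMulLinear, injective_iff_map_eq_zero]
    intro y hy
    have hzero : ∀ h ∈ entrySpan v, (∑ b, y b • φ b) h = 0 := by
      intro h hh
      induction hh using Submodule.span_induction with
      | mem h hh =>
        obtain ⟨p, rfl⟩ := hh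
        simpa [Matrix.vecMulLinear_apply, Matrix.vecMul, dotProduct, T'] using congrFun hy p
      | zero => simp
      | add a b _ _ ha hb => rw [map_add, ha, hb, add_zero]
      | smul c a _ ha => rw [map_smul, ha, smul_zero]
    funext a
    simpa [hφx] using hzero (x a) (hxC a)
  have hPA : P.map (algebraMap ℂ H) =
      ∑ k, (T k).map (algebraMap ℂ H) * ((T k).map (algebraMap ℂ H))ᴴ := by
    simp only [map_algebraMap_conjTranspose]
    ext a b
    simp [P, Matrix.sum_apply, Matrix.mul_apply]
  have hPdet := (Matrix.isUnit_iff_isUnit_det P).mp hP.isUnit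
  have hPP : P.map (algebraMap ℂ H) * P⁻¹.map (algebraMap ℂ H) = 1 := by
    rw [← Matrix.map_mul, Matrix.mul_nonsing_inv _ hPdet]; simp
  have hPP' : P⁻¹.map (algebraMap ℂ H) * P.map (algebraMap ℂ H) = 1 := by
    rw [← Matrix.map_mul, Matrix.nonsing_inv_mul _ hPdet]; simp
  -- It is enough to check this after multiplying by the invertible `P`, where `T k` trades `s` for
  -- `v` and `S(s)` for `vᴴ`.
  have hSs : s.map (HopfAlgebra.antipode ℂ) * s = 1 := by
    have h : s.map (HopfAlgebra.antipode ℂ) * s * P.map (algebraMap ℂ H) =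
        P.map (algebraMap ℂ H) := by
      rw [hPA, Finset.mul_sum]
      refine Finset.sum_congr rfl fun k _ => ?_
      rw [← Matrix.mul_assoc, Matrix.mul_assoc (s.map _), hsT, ← Matrix.mul_assoc, hST,
        Matrix.mul_assoc _ vᴴ, hv1, Matrix.mul_one]
    rw [← Matrix.mul_one (s.map _ * s), ← hPP, ← Matrix.mul_assoc, h]
  have hsP : s * P.map (algebraMap ℂ H) * sᴴ = P.map (algebraMap ℂ H) := by
    rw [hPA, Finset.mul_sum, Finset.sum_mul]
    refine Finset.sum_congr rfl fun k _ => ?_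
    rw [← Matrix.mul_assoc, Matrix.mul_assoc (s * _), ← Matrix.conjTranspose_mul, hsT,
      Matrix.conjTranspose_mul, Matrix.mul_assoc, ← Matrix.mul_assoc v, hv2, Matrix.one_mul]
  have hsP' : sᴴ * P⁻¹.map (algebraMap ℂ H) * s = P⁻¹.map (algebraMap ℂ H) := by
    have h1 : P.map (algebraMap ℂ H) * sᴴ =
        s.map (HopfAlgebra.antipode ℂ) * P.map (algebraMap ℂ H) := by
      conv_rhs => rw [← hsP]
      rw [← Matrix.mul_assoc, ← Matrix.mul_assoc, hSs, Matrix.one_mul]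
    have h2 : sᴴ * P⁻¹.map (algebraMap ℂ H) =
        P⁻¹.map (algebraMap ℂ H) * s.map (HopfAlgebra.antipode ℂ) := by
      rw [← Matrix.one_mul sᴴ, ← hPP', Matrix.mul_assoc (P⁻¹.map _), h1, Matrix.mul_assoc,
        Matrix.mul_assoc, hPP, Matrix.mul_one]
    rw [h2, Matrix.mul_assoc, hSs, Matrix.mul_one]
  -- The inner product `P⁻¹` of `C`, pulled back along all the `M i` together.
  refine ⟨∑ i, (M i)ᴴ * P⁻¹ * M i, ?_, ?_⟩
  · let M' : Matrix (Fin N × ι) ι ℂ := 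
      .of fun p j => φ p.1 (r p.2 j)
    have hM : ∑ i, (M i)ᴴ * P⁻¹ * M i =
        M'ᴴ * (Matrix.kroneckerMap (· * ·) P⁻¹ (1 : Matrix ι ι ℂ)) * M' := by
      ext a b
      simp only [Matrix.sum_apply, Matrix.mul_apply, Matrix.conjTranspose_apply,
        Fintype.sum_prod_type, Matrix.kroneckerMap_apply, Matrix.one_apply, M, M', Matrix.of_apply, mul_ite,
        mul_one, mul_zero, Finset.sum_ite_eq', Finset.mem_univ, if_true]
      rw [Finset.sum_comm]
    rw [hM]
    refine Matrix.PosDef.conjTranspose_mul_mul_same (hP.inv.kronecker .one) ?_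
    rw [← Matrix.coe_mulVecLin, injective_iff_map_eq_zero]
    intro y hy
    funext i
    -- The `M i` are jointly injective: applying the counit to this relation returns `y i = 0`.
    have h : ∑ j, y j • r i j = 0 := by
      rw [← hC (∑ j, y j • r i j)
        (Submodule.sum_mem _ fun j _ => Submodule.smul_mem _ _ (hrv i j))]
      refine Finset.sum_eq_zero fun b _ => ?_
      have : ∑ j, φ b (r i j) * y j = 0 := congrFun hy (b, i)
      simp [mul_comm (y _), this]
    have := congr(Coalgebra.counit (R := ℂ) $h)
    simpa [hr.counit] using this
  · have hQ : (∑ i, (M i)ᴴ * P⁻¹ * M i).map (algebraMap ℂ H) =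
        ∑ i, ((M i).map (algebraMap ℂ H))ᴴ * P⁻¹.map (algebraMap ℂ H) *
          (M i).map (algebraMap ℂ H) := by
      simp only [map_algebraMap_conjTranspose]
      ext a b
      simp [Matrix.sum_apply, Matrix.mul_apply]
    rw [hQ, Finset.mul_sum, Finset.sum_mul]
    refine Finset.sum_congr rfl fun i _ => ?_
    calc _ = ((M i).map (algebraMap ℂ H) * r)ᴴ * P⁻¹.map (algebraMap ℂ H) *
          ((M i).map (algebraMap ℂ H) * r) := by
          simp only [Matrix.conjTranspose_mul, Matrix.mul_assoc]
      _ = ((M i).map (algebraMap ℂ H))ᴴ * (sᴴ * P⁻¹.map (algebraMap ℂ H) * s) *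
          (M i).map (algebraMap ℂ H) := by
          rw [← hsM]
          simp only [Matrix.conjTranspose_mul, Matrix.mul_assoc]
      _ = _ := by rw [hsP']

end Invariant

/-! ### A criterion for CQG algebras -/

section Criterion

/-- In this form scalar matrices can be moved by matrix algebra over `C ⊗ C`, since algebra maps fix
scalars. -/
theorem comul_iff_map_eq_mul {K C ι : Type*} [Field K] [Ring C] [Bialgebra K C] [Fintype ι]
    (r : Matrix ι ι C) :
    (∀ i j, Coalgebra.comul (R := K) (r i j) = ∑ k, r i k ⊗ₜ[K] r k j) ↔
      r.map (Bialgebra.comulAlgHom K C) =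
        r.map (Algebra.TensorProduct.includeLeft : C →ₐ[K] C ⊗[K] C) *
          r.map (Algebra.TensorProduct.includeRight : C →ₐ[K] C ⊗[K] C) := by
  simp [← Matrix.ext_iff, Matrix.mul_apply]

/-- Conjugating a corepresentation by an invertible scalar matrix gives a corepresentation. -/
theorem IsCorep.conj {K C ι : Type*} [Field K] [Ring C] [Bialgebra K C]
    [Fintype ι] [DecidableEq ι] {r : Matrix ι ι C} (hr : IsCorep K r) {B B' : Matrix ι ι K}
    (h : B * B' = 1) :
    IsCorep K (B.map (algebraMap K C) * r * B'.map (algebraMap K C)) where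
  comul := by
    have hmap (f : C →ₐ[K] C ⊗[K] C) :
        (B.map (algebraMap K C) * r * B'.map (algebraMap K C)).map f =
          B.map (algebraMap K (C ⊗[K] C)) * r.map f * B'.map (algebraMap K (C ⊗[K] C)) := by
      have hf : ⇑f ∘ ⇑(algebraMap K C) = algebraMap K (C ⊗[K] C) := funext f.commutes
      rw [Matrix.map_mul, Matrix.map_mul, Matrix.map_map, Matrix.map_map, hf]
    have h' : B'.map (algebraMap K (C ⊗[K] C)) * B.map (algebraMap K (C ⊗[K] C)) = 1 := by
      rw [← Matrix.map_mul, mul_eq_one_comm.mp h, Matrix.map_one _ (map_zero _) (map_one _)]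
    rw [comul_iff_map_eq_mul, hmap, hmap, hmap, (comul_iff_map_eq_mul r).mp hr.comul]
    simp only [Matrix.mul_assoc]
    rw [← Matrix.mul_assoc (B'.map _) (B.map _), h', Matrix.one_mul]
  counit i j := by
    have hc : r.map (Bialgebra.counitAlgHom K C) = 1 := by
      ext i j
      simp [hr.counit, Matrix.one_apply]
    have : (B.map (algebraMap K C) * r * B'.map (algebraMap K C)).map
        (Bialgebra.counitAlgHom K C) = 1 := by
      have hf : ⇑(Bialgebra.counitAlgHom K C) ∘ ⇑(algebraMap K C) = id :=
        funext (Bialgebra.counitAlgHom K C).commutes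
      rw [Matrix.map_mul, Matrix.map_mul, Matrix.map_map, Matrix.map_map, hc, hf, Matrix.map_id,
        Matrix.map_id, Matrix.mul_one, h]
    simpa [Matrix.one_apply] using congr($this i j)

variable {H : Type*} [Ring H] [HopfAlgebra ℂ H]

theorem IsCorep.fromBlocks {κ l : Type*} [Fintype κ] [DecidableEq κ] [Fintype l] [DecidableEq l]
    {v : Matrix κ κ H} {w : Matrix l l H} (hv : IsCorep ℂ v) (hw : IsCorep ℂ w) :
    IsCorep ℂ (Matrix.fromBlocks v 0 0 w) where
  comul i j := by
    rcases i with i | i <;> rcases j with j | j <;> simp [hv.comul, hw.comul]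
  counit i j := by
    rcases i with i | i <;> rcases j with j | j <;> simp [hv.counit, hw.counit]

theorem IsCorep.kronecker {κ l : Type*} [Fintype κ] [DecidableEq κ] [Fintype l] [DecidableEq l]
    {v : Matrix κ κ H} {w : Matrix l l H} (hv : IsCorep ℂ v) (hw : IsCorep ℂ w) :
    IsCorep ℂ (Matrix.kroneckerMap (· * ·) v w) where
  comul i j := by
    simp [hv.comul, hw.comul, Finset.sum_mul_sum, Fintype.sum_prod_type]
  counit i j := by
    simp only [kroneckerMap_apply, Bialgebra.counit_mul, hv.counit, hw.counit, Prod.ext_iff]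
    split_ifs <;> simp_all

theorem Matrix.fromBlocks_mem_unitary {A κ l : Type*} [Ring A] [StarRing A]
    [Fintype κ] [DecidableEq κ] [Fintype l] [DecidableEq l]
    {v : Matrix κ κ A} {w : Matrix l l A} (hv : v ∈ unitary (Matrix κ κ A))
    (hw : w ∈ unitary (Matrix l l A)) :
    Matrix.fromBlocks v 0 0 w ∈ unitary (Matrix (κ ⊕ l) (κ ⊕ l) A) := by
  rw [Unitary.mem_iff, Matrix.star_eq_conjTranspose] at hv hw ⊢
  simp [Matrix.fromBlocks_conjTranspose, Matrix.fromBlocks_multiply, hv, hw,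
    Matrix.fromBlocks_one]

theorem Matrix.kroneckerMap_mul_mem_unitary {A κ l : Type*} [Ring A] [StarRing A]
    [Fintype κ] [DecidableEq κ] [Fintype l] [DecidableEq l]
    {v : Matrix κ κ A} {w : Matrix l l A} (hv : v ∈ unitary (Matrix κ κ A))
    (hw : w ∈ unitary (Matrix l l A)) :
    Matrix.kroneckerMap (· * ·) v w ∈ unitary (Matrix (κ × l) (κ × l) A) := by
  rw [Unitary.mem_iff, Matrix.star_eq_conjTranspose] at hv hw ⊢
  have hv1 : ∀ i j, ∑ k, star (v k i) * v k j = if i = j then 1 else 0 := fun i j => by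
    simpa [Matrix.mul_apply, Matrix.one_apply] using congr($(hv.1) i j)
  have hv2 : ∀ i j, ∑ k, v i k * star (v j k) = if i = j then 1 else 0 := fun i j => by
    simpa [Matrix.mul_apply, Matrix.one_apply] using congr($(hv.2) i j)
  have hw1 : ∀ i j, ∑ k, star (w k i) * w k j = if i = j then 1 else 0 := fun i j => by
    simpa [Matrix.mul_apply, Matrix.one_apply] using congr($(hw.1) i j)
  have hw2 : ∀ i j, ∑ k, w i k * star (w j k) = if i = j then 1 else 0 := fun i j => by
    simpa [Matrix.mul_apply, Matrix.one_apply] using congr($(hw.2) i j)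
  constructor
  -- Entries of `v` and `w` need not commute. The star reverses products, so here the `v` factors
  -- are adjacent and are summed first; in the other identity the `w` factors are.
  · ext ⟨a, b⟩ ⟨c, d⟩
    have h : ∀ j, ∑ i, star (v i a * w j b) * (v i c * w j d) =
        if a = c then star (w j b) * w j d else 0 := fun j => by
      calc _ = star (w j b) * (∑ i, star (v i a) * v i c) * w j d := by
            simp only [star_mul, Finset.mul_sum, Finset.sum_mul, mul_assoc]
        _ = _ := by rw [hv1]; split_ifs <;> simp
    simp only [Matrix.mul_apply, Matrix.conjTranspose_apply, kroneckerMap_apply,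
      Fintype.sum_prod_type_right, h, Matrix.one_apply, Prod.mk.injEq]
    by_cases hac : a = c <;> simp [hac, hw1]
  · ext ⟨a, b⟩ ⟨c, d⟩
    have h : ∀ i, ∑ j, v a i * w b j * star (v c i * w d j) =
        if b = d then v a i * star (v c i) else 0 := fun i => by
      calc _ = v a i * (∑ j, w b j * star (w d j)) * star (v c i) := by
            simp only [star_mul, Finset.mul_sum, Finset.sum_mul, mul_assoc]
        _ = _ := by rw [hw2]; split_ifs <;> simp
    simp only [Matrix.mul_apply, Matrix.conjTranspose_apply, kroneckerMap_apply,
      Fintype.sum_prod_type, h, Matrix.one_apply, Prod.mk.injEq]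
    by_cases hac : b = d <;> simp [hac, hv2]

variable [StarRing H]

variable (H) in
/-- Linear combinations of coefficients of a unitary corepresentation; these form a subalgebra. -/
def unitaryCoeffs : Subalgebra ℂ H where
  carrier := {a | ∃ (κ : Type) (_ : Fintype κ) (_ : DecidableEq κ) (v : Matrix κ κ H),
    IsCorep ℂ v ∧ v ∈ unitary (Matrix κ κ H) ∧ a ∈ entrySpan v}
  mul_mem' := by
    rintro a b ⟨κ, _, _, v, hv, hvu, ha⟩ ⟨l, _, _, w, hw, hwu, hb⟩
    refine ⟨κ × l, inferInstance, inferInstance, _, hv.kronecker hw,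
      Matrix.kroneckerMap_mul_mem_unitary hvu hwu, ?_⟩
    have h := Submodule.mul_mem_mul ha hb
    rw [entrySpan, entrySpan, Submodule.span_mul_span] at h
    refine Submodule.span_mono ?_ h
    rintro _ ⟨_, ⟨p, rfl⟩, _, ⟨q, rfl⟩, rfl⟩
    exact ⟨((p.1, q.1), (p.2, q.2)), rfl⟩
  add_mem' := by
    rintro a b ⟨κ, _, _, v, hv, hvu, ha⟩ ⟨l, _, _, w, hw, hwu, hb⟩
    refine ⟨κ ⊕ l, inferInstance, inferInstance, _, hv.fromBlocks hw,
      Matrix.fromBlocks_mem_unitary hvu hwu, Submodule.add_mem _ ?_ ?_⟩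
    · refine Submodule.span_mono ?_ ha
      rintro _ ⟨p, rfl⟩
      exact ⟨(Sum.inl p.1, Sum.inl p.2), rfl⟩
    · refine Submodule.span_mono ?_ hb
      rintro _ ⟨p, rfl⟩
      exact ⟨(Sum.inr p.1, Sum.inr p.2), rfl⟩
  algebraMap_mem' c := by
    refine ⟨Unit, inferInstance, inferInstance, 1, ⟨?_, ?_⟩, Submonoid.one_mem _, ?_⟩
    · intro i j
      simp [Algebra.TensorProduct.one_def]
    · intro i j
      simp
    · rw [Algebra.algebraMap_eq_smul_one]
      exact Submodule.smul_mem _ _ (mem_entrySpan (1 : Matrix Unit Unit H) () ())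

/-- Finitely many elements of `unitaryCoeffs H` come from a common unitary corepresentation. -/
theorem exists_unitary_corep (s : Finset H) (hs : ∀ a ∈ s, a ∈ unitaryCoeffs H) :
    ∃ (κ : Type) (_ : Fintype κ) (_ : DecidableEq κ) (v : Matrix κ κ H),
      IsCorep ℂ v ∧ v ∈ unitary (Matrix κ κ H) ∧ ∀ a ∈ s, a ∈ entrySpan v := by
  classical
  induction s using Finset.induction_on with
  | empty =>
    obtain ⟨κ, i1, i2, v, hv, hvu, -⟩ := (unitaryCoeffs H).one_mem
    exact ⟨κ, i1, i2, v, hv, hvu, by simp⟩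
  | insert a s _ ih =>
    obtain ⟨κ, i1, i2, v, hv, hvu, hsv⟩ := ih fun b hb => hs b (Finset.mem_insert_of_mem hb)
    obtain ⟨l, i3, i4, w, hw, hwu, haw⟩ := hs a (Finset.mem_insert_self _ _)
    refine ⟨κ ⊕ l, inferInstance, inferInstance, _, hv.fromBlocks hw,
      Matrix.fromBlocks_mem_unitary hvu hwu, fun b hb => ?_⟩
    rcases Finset.mem_insert.mp hb with rfl | hb
    · refine Submodule.span_mono ?_ haw
      rintro _ ⟨p, rfl⟩
      exact ⟨(Sum.inr p.1, Sum.inr p.2), rfl⟩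
    · refine Submodule.span_mono ?_ (hsv b hb)
      rintro _ ⟨p, rfl⟩
      exact ⟨(Sum.inl p.1, Sum.inl p.2), rfl⟩

variable [StarModule ℂ H]

/-- A Hopf `*`-algebra spanned by coefficients of unitary corepresentations is a CQG algebra. -/
theorem IsHopfStarAlgebra.isCQGAlgebra (hH : IsHopfStarAlgebra H) (h : unitaryCoeffs H = ⊤) :
    IsCQGAlgebra H where
  toIsHopfStarAlgebra := hH
  unitarizable V _ _ _ ρ hρ := by
    classical
    let b := Module.finBasis ℂ V
    let r : Matrix (Fin (Module.finrank ℂ V)) (Fin (Module.finrank ℂ V)) H :=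
      .of fun i j => tensorCoeff b i (ρ (b j))
    have hρr : ∀ j, ρ (b j) = ∑ i, b i ⊗ₜ[ℂ] r i j := fun j =>
      (sum_tmul_tensorCoeff b (ρ (b j))).symm
    have hr : IsCorep ℂ r := hρ.isCorep b hρr
    obtain ⟨κ, _, _, v, hv, hvu, hrv⟩ := exists_unitary_corep
      (Finset.univ.image fun p : _ × _ => r p.1 p.2) (fun a _ => h ▸ Algebra.mem_top)
    obtain ⟨Q, hQ, hrQ⟩ := hr.exists_posDef hv hvu fun i j =>
      hrv _ (Finset.mem_image.mpr ⟨(i, j), Finset.mem_univ _, rfl⟩)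
    -- `B` changes to coordinates orthonormal for `Q`, in which the comodule has matrix `w`.
    obtain ⟨B, hB, rfl⟩ := hQ.exists_conjTranspose_mul_self
    have hBdet := (Matrix.isUnit_iff_isUnit_det B).mp hB
    have hB1 := Matrix.mul_nonsing_inv _ hBdet
    have hB2 := Matrix.nonsing_inv_mul _ hBdet
    have hA1 : B.map (algebraMap ℂ H) * B⁻¹.map (algebraMap ℂ H) = 1 := by
      rw [← Matrix.map_mul, hB1]; simp
    have hA2 : B⁻¹.map (algebraMap ℂ H) * B.map (algebraMap ℂ H) = 1 := by
      rw [← Matrix.map_mul, hB2]; simp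
    let w := B.map (algebraMap ℂ H) * r * B⁻¹.map (algebraMap ℂ H)
    have hw : IsCorep ℂ w := hr.conj hB1
    have hw1 : wᴴ * w = 1 := by
      rw [Matrix.map_mul, ← map_algebraMap_conjTranspose] at hrQ
      calc wᴴ * w = (B⁻¹.map (algebraMap ℂ H))ᴴ *
            (rᴴ * ((B.map (algebraMap ℂ H))ᴴ * B.map (algebraMap ℂ H)) * r) *
            B⁻¹.map (algebraMap ℂ H) := by
            simp only [w, Matrix.conjTranspose_mul, Matrix.mul_assoc]
        _ = ((B.map (algebraMap ℂ H)) * (B⁻¹.map (algebraMap ℂ H)))ᴴ *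
            (B.map (algebraMap ℂ H) * B⁻¹.map (algebraMap ℂ H)) := by
            rw [hrQ]
            simp only [Matrix.conjTranspose_mul, Matrix.mul_assoc]
        _ = 1 := by rw [hA1]; simp
    -- Over a noncommutative ring a left inverse need not be a right one; here both equal `S(w)`.
    have hw2 : w * wᴴ = 1 := by
      have : wᴴ = w.map (HopfAlgebra.antipode ℂ) := by
        rw [← Matrix.mul_one wᴴ, ← hw.mul_antipode, ← Matrix.mul_assoc, hw1, Matrix.one_mul]
      rw [this, hw.mul_antipode]
    let o := (EuclideanSpace.basisFun (Fin (Module.finrank ℂ V)) ℂ).toBasis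
    have ho : ∀ i, o i = EuclideanSpace.single i 1 := fun i => by simp [o]
    let σ := o.constr ℂ fun j => ∑ i, o i ⊗ₜ[ℂ] w i j
    have hσ : ∀ j, σ (o j) = ∑ i, o i ⊗ₜ[ℂ] w i j := fun j => o.constr_basis ℂ _ j
    let e : V ≃ₗ[ℂ] EuclideanSpace ℂ (Fin (Module.finrank ℂ V)) :=
      LinearEquiv.ofLinearMap (Matrix.toLin b o B) (Matrix.toLin o b B⁻¹)
        (by rw [← Matrix.toLin_mul, hB1, Matrix.toLin_one])
        (by rw [← Matrix.toLin_mul, hB2, Matrix.toLin_one])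
    have he : ∀ j, e (b j) = ∑ i, B i j • o i := fun j => Matrix.toLin_self b o B j
    refine ⟨_, σ, e, ⟨hw.isComodule o hσ, w, Unitary.mem_iff.mpr ⟨hw1, hw2⟩, fun j => ?_⟩,
      b.ext fun j => ?_⟩
    · simp only [← ho, hσ]
    · have hwB : w * B.map (algebraMap ℂ H) = B.map (algebraMap ℂ H) * r := by
        rw [Matrix.mul_assoc, hA2, Matrix.mul_one]
      have hentry : ∀ k, ∑ i, B i j • w k i = ∑ i, B k i • r i j := fun k => by
        simpa [Matrix.mul_apply, ← Algebra.commutes, ← Algebra.smul_def] using congr($hwB k j)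
      simp only [LinearMap.comp_apply, LinearEquiv.coe_coe, hρr, map_sum, LinearMap.rTensor_tmul,
        he, map_smul, hσ, TensorProduct.sum_tmul, Finset.smul_sum]
      rw [Finset.sum_comm]
      conv_rhs => rw [Finset.sum_comm]
      refine Finset.sum_congr rfl fun k _ => ?_
      simp only [← TensorProduct.tmul_smul, TensorProduct.smul_tmul, ← TensorProduct.tmul_sum,
        hentry]

end Criterion

/-! ### `A_s(n, ℂ)` is a CQG algebra coacting on `ℂ^n` -/

namespace QuantumPerm

variable (n : ℕ)

theorem isCorep_u (K : Type*) [Field K] : IsCorep K (Matrix.of (u K n)) where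
  comul i j := by simp
  counit i j := by simp

/-- The entries are self-adjoint, so the product relations kill the off-diagonal entries of `uᴴ u`
and `u uᴴ`, and the sum relations give the diagonal. -/
theorem u_mem_unitary :
    Matrix.of (u ℂ n) ∈ unitary (Matrix (Fin n) (Fin n) (QuantumPerm ℂ n)) := by
  rw [Unitary.mem_iff, Matrix.star_eq_conjTranspose]
  constructor <;> ext i j <;>
    simp only [Matrix.mul_apply, Matrix.conjTranspose_apply, Matrix.of_apply, star_u,
      (isMagic_u ℂ n).row_mul, (isMagic_u ℂ n).col_mul, Matrix.one_apply] <;>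
    split_ifs <;> simp [(isMagic_u ℂ n).col_sum, (isMagic_u ℂ n).row_sum]

theorem isHopfStarAlgebra : IsHopfStarAlgebra (QuantumPerm ℂ n) where
  comul_star a := by
    induction a using QuantumPerm.induction with
    | hu i j => simp [star_sum, TensorProduct.star_tmul]
    | hK c => simp [← algebraMap_star_comm, Bialgebra.comul_algebraMap]
    | hadd a b ha hb => simp only [star_add, map_add, ha, hb]
    | hmul a b ha hb => simp only [star_mul, Bialgebra.comul_mul, ha, hb]
  counit_star a := by
    induction a using QuantumPerm.induction with
    | hu i j => simp
    | hK c => simp [← algebraMap_star_comm]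
    | hadd a b ha hb => simp only [star_add, map_add, ha, hb]
    | hmul a b ha hb => simp only [star_mul, Bialgebra.counit_mul, ha, hb]

theorem unitaryCoeffs_eq_top : unitaryCoeffs (QuantumPerm ℂ n) = ⊤ := by
  refine Algebra.eq_top_iff.mpr fun a => ?_
  induction a using QuantumPerm.induction with
  | hu i j =>
    exact ⟨Fin n, inferInstance, inferInstance, _, isCorep_u n ℂ, u_mem_unitary n,
      mem_entrySpan _ i j⟩
  | hK c => exact Subalgebra.algebraMap_mem _ c
  | hadd a b ha hb => exact add_mem ha hb
  | hmul a b ha hb => exact mul_mem ha hb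

theorem isCQGAlgebra : IsCQGAlgebra (QuantumPerm ℂ n) :=
  (isHopfStarAlgebra n).isCQGAlgebra (unitaryCoeffs_eq_top n)

theorem isCoaction_coaction (K : Type*) [Field K] : IsCoaction (coaction K n) :=
  (isCorep_u n K).isComodule (Pi.basisFun K (Fin n)) fun j => by simp

theorem isStarCoaction_coaction : IsStarCoaction (coaction ℂ n) where
  isCoaction := isCoaction_coaction n ℂ
  map_star a := by
    have ha : a = ∑ i, a i • Pi.single i 1 := by
      simpa using ((Pi.basisFun ℂ (Fin n)).sum_repr a).symm
    rw [ha]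
    simp only [star_sum, star_smul, map_sum, map_smul, ← Pi.single_star, star_one, coaction_single,
      TensorProduct.star_tmul, star_u]

end QuantumPerm

/-! ### Coactions on `ℂ^n` -/

section Coaction

variable {H : Type*} [Ring H] [HopfAlgebra ℂ H] {n : ℕ}

/-- If `φ` is an invariant functional of a coaction on `ℂ^n` with matrix `x`, then
`φ k • x k i = φ i • S (x i k)`. -/
theorem IsCorep.smul_eq_smul_antipode {x : Matrix (Fin n) (Fin n) H} (hx : IsCorep ℂ x)
    (hmul : ∀ i j k, x k i * x k j = if i = j then x k i else 0) {φ : Fin n → ℂ}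
    (hφ : ∀ i, ∑ k, φ k • x k i = algebraMap ℂ H (φ i)) (i k : Fin n) :
    φ k • x k i = φ i • HopfAlgebra.antipode ℂ (x i k) := by
  let D : Matrix (Fin n) (Fin n) H := Matrix.diagonal fun i => algebraMap ℂ H (φ i)
  -- The row relations reduce entry `(i, j)` to `δ i j` times the sum in `hφ`.
  have h : xᵀ * D * x = D := by
    ext i j
    have : ∀ k, x k i * algebraMap ℂ H (φ k) * x k j = if i = j then φ k • x k i else 0 :=
      fun k => by
        rw [← Algebra.commutes, mul_assoc, hmul, ← Algebra.smul_def, smul_ite, smul_zero]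
    simp only [D, Matrix.mul_apply (M := xᵀ * _), Matrix.mul_diagonal,
      Matrix.transpose_apply, this,
      Matrix.diagonal_apply]
    split_ifs <;> simp [hφ]
  have h' : xᵀ * D = D * x.map (HopfAlgebra.antipode ℂ) := by
    conv_rhs => rw [← h]
    rw [Matrix.mul_assoc, hx.mul_antipode, Matrix.mul_one]
  have := congr($h' i k)
  simpa [D, Matrix.mul_diagonal, Matrix.diagonal_mul, ← Algebra.commutes, ← Algebra.smul_def]
    using this

variable [StarRing H]

/-- A coaction on `ℂ^n` leaving an inner product invariant has for each `i` an invariant functional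
which does not vanish at `i`. -/
theorem IsCorep.exists_invariant_functional {x : Matrix (Fin n) (Fin n) H} (hx : IsCorep ℂ x)
    (hmul : ∀ i j k, x k i * x k j = if i = j then x k i else 0)
    (hsum : ∀ i, ∑ k, x i k = 1) (hstar : ∀ i j, star (x i j) = x i j)
    {Q : Matrix (Fin n) (Fin n) ℂ} (hQ : Q.PosDef)
    (hxQ : xᴴ * Q.map (algebraMap ℂ H) * x = Q.map (algebraMap ℂ H)) (i : Fin n) :
    ∃ φ : Fin n → ℂ, (∀ i, ∑ k, φ k • x k i = algebraMap ℂ H (φ i)) ∧ φ i ≠ 0 := by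
  classical
  by_contra! hi
  -- The common zeros of all invariant functionals, assumed to contain `i`. The matrix `x` turns out
  -- to be block diagonal for `Z` and its complement.
  let Z : Finset (Fin n) := Finset.univ.filter fun i => ∀ φ : Fin n → ℂ,
    (∀ i, ∑ k, φ k • x k i = algebraMap ℂ H (φ i)) → φ i = 0
  have hiZ : i ∈ Z := by simpa [Z] using hi
  have hcol : ∀ k ∉ Z, ∀ j ∈ Z, x k j = 0 := by
    intro k hk j hj
    simp only [Z, Finset.mem_filter, Finset.mem_univ, true_and, not_forall] at hk hj
    obtain ⟨φ, hφ, hφk⟩ := hk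
    have := hx.smul_eq_smul_antipode hmul hφ j k
    rw [hj φ hφ, zero_smul] at this
    exact (smul_eq_zero.mp this).resolve_left hφk
  have hrow : ∀ k ∈ Z, ∀ j ∉ Z, x k j = 0 := by
    intro k hk j hj
    have h1 : ∑ l, x k l * HopfAlgebra.antipode ℂ (x l k) = 1 := by
      simpa [Matrix.mul_apply] using congr($(hx.mul_antipode) k k)
    -- In `x k j * x k l * S (x l k)`, the row relations kill the terms with `l ∈ Z` and `hcol`
    -- those with `l ∉ Z`.
    rw [← mul_one (x k j), ← h1, Finset.mul_sum]
    refine Finset.sum_eq_zero fun l _ => ?_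
    by_cases hl : l ∈ Z
    · rw [← mul_assoc, hmul, if_neg (by rintro rfl; exact hj hl), zero_mul]
    · rw [hcol l hl k hk, map_zero, mul_zero, mul_zero]
  let y : Fin n → ℂ := fun k => if k ∈ Z then 1 else 0
  have hxy : ∀ k, ∑ j, y j • x k j = algebraMap ℂ H (y k) := by
    intro k
    by_cases hk : k ∈ Z
    · have : ∀ j, y j • x k j = x k j := fun j => by
        by_cases hj : j ∈ Z
        · simp [y, hj]
        · simp [hrow k hk j hj]
      simp [this, hsum, y, hk]
    · have : ∀ j, y j • x k j = 0 := fun j => by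
        by_cases hj : j ∈ Z
        · simp [hcol k hk j hj]
        · simp [y, hj]
      simp [this, y, hk]
  let E : Matrix Unit (Fin n) ℂ := .of fun _ => y
  have hE : E.map (algebraMap ℂ H) * xᴴ = E.map (algebraMap ℂ H) := by
    ext a k
    simpa [Matrix.mul_apply, E, hstar, ← Algebra.smul_def] using hxy k
  -- Pairing with the fixed vector `y` in the invariant inner product `Q` is an invariant
  -- functional.
  have hEQ : (E * Q).map (algebraMap ℂ H) * x = (E * Q).map (algebraMap ℂ H) := by
    rw [Matrix.map_mul]
    conv_lhs => rw [← hE]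
    rw [Matrix.mul_assoc, Matrix.mul_assoc, ← Matrix.mul_assoc xᴴ, hxQ]
  have hinv : ∀ j, ∑ k, (E * Q) () k • x k j = algebraMap ℂ H ((E * Q) () j) := fun j => by
    have := congr($hEQ () j)
    rw [Matrix.mul_apply] at this
    simpa only [Matrix.map_apply, ← Algebra.smul_def] using this
  have hy : y ≠ 0 := fun h => by simpa [y, hiZ] using congrFun h i
  -- That functional vanishes on `Z`, while `y` is supported there, so `y` would have norm zero.
  refine (hQ.dotProduct_mulVec_pos hy).ne' ?_
  have hys : star y = y := by
    funext k
    simp only [y, Pi.star_apply]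
    split_ifs <;> simp
  rw [hys, Matrix.dotProduct_mulVec, dotProduct]
  refine Finset.sum_eq_zero fun k _ => ?_
  by_cases hk : k ∈ Z
  · have h0 : (E * Q) () k = 0 := (Finset.mem_filter.mp hk).2 _ hinv
    have : (y ᵥ* Q) k = (E * Q) () k := rfl
    rw [this, h0, zero_mul]
  · simp [y, hk]

/-- The matrix of a coaction on `ℂ^n` leaving an inner product invariant is magic. -/
theorem IsCorep.isMagic {x : Matrix (Fin n) (Fin n) H} (hx : IsCorep ℂ x)
    (hmul : ∀ i j k, x k i * x k j = if i = j then x k i else 0)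
    (hsum : ∀ i, ∑ k, x i k = 1) (hstar : ∀ i j, star (x i j) = x i j)
    {Q : Matrix (Fin n) (Fin n) ℂ} (hQ : Q.PosDef)
    (hxQ : xᴴ * Q.map (algebraMap ℂ H) * x = Q.map (algebraMap ℂ H)) : IsMagic x := by
  choose φ hφ hφ0 using hx.exists_invariant_functional hmul hsum hstar hQ hxQ
  have hxS : ∀ i j, ∑ k, x i k * HopfAlgebra.antipode ℂ (x k j) = if i = j then 1 else 0 :=
    fun i j => by simpa [Matrix.mul_apply, Matrix.one_apply] using congr($(hx.mul_antipode) i j)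
  have hS : ∀ i k, HopfAlgebra.antipode ℂ (x i k) = ((φ i i)⁻¹ * φ i k) • x k i := fun i k => by
    rw [mul_smul, hx.smul_eq_smul_antipode hmul (hφ i), smul_smul, inv_mul_cancel₀ (hφ0 i),
      one_smul]
  -- The scalar in `hS` must be absorbed: expanding `x k i * ∑ l, x k l * S (x l k)` leaves `x k i *
  -- S (x i k)`, which is `S (x i k)` because `S (x i k)` is a multiple of the idempotent `x k i`.
  have hS' : ∀ i k, HopfAlgebra.antipode ℂ (x i k) = x k i := fun i k => by
    rw [← mul_one (x k i)]
    have h1 := hxS k k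
    rw [if_pos rfl] at h1
    conv_rhs => rw [← h1]
    rw [hS, Finset.mul_sum]
    simp [hS, hmul]
  simp only [hS'] at hxS
  refine ⟨hmul, hsum, fun i j k => ?_, fun i => ?_⟩
  · by_cases hij : i = j
    · subst hij
      simp [hmul]
    · have := hxS i j
      rw [if_neg hij] at this
      -- Left multiplication by `x i k` isolates the `k`th term of `∑ l, x i l * x j l = 0`.
      have h := congr(x i k * $this)
      simp only [Finset.mul_sum, ← mul_assoc, hmul, ite_mul, zero_mul, mul_zero,
        Finset.sum_ite_eq, Finset.mem_univ, if_true] at h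
      rw [h, if_neg hij]
  · refine (Finset.sum_congr rfl fun k _ => (hS' i k).symm).trans ?_
    rw [← map_sum, hsum, HopfAlgebra.antipode_one]

variable [StarModule ℂ H]

/-- The matrix of a comodule over a CQG algebra leaves an inner product invariant. -/
theorem IsCQGAlgebra.exists_posDef (hH : IsCQGAlgebra H) {V : Type} [AddCommGroup V] [Module ℂ V]
    {ι : Type*} [Fintype ι] [DecidableEq ι]
    (b : Module.Basis ι ℂ V) {ρ : V →ₗ[ℂ] V ⊗[ℂ] H} (hρ : IsComodule ρ)
    {x : Matrix ι ι H} (hx : ∀ j, ρ (b j) = ∑ i, b i ⊗ₜ[ℂ] x i j) :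
    ∃ Q : Matrix ι ι ℂ, Q.PosDef ∧
      xᴴ * Q.map (algebraMap ℂ H) * x = Q.map (algebraMap ℂ H) := by
  have : FiniteDimensional ℂ V := b.finiteDimensional_of_finite
  obtain ⟨m, σ, e, ⟨-, w, hw, hσ⟩, he⟩ := hH.unitarizable V ρ hρ
  let o := (EuclideanSpace.basisFun (Fin m) ℂ).toBasis
  have ho : ∀ i, o i = EuclideanSpace.single i 1 := fun i => by simp [o]
  simp only [← ho] at hσ
  let B : Matrix (Fin m) ι ℂ := .of fun i j => o.repr (e (b j)) i
  have heB : ∀ j, e (b j) = ∑ i, B i j • o i := fun j => (o.sum_repr (e (b j))).symm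
  have hBx : B.map (algebraMap ℂ H) * x = Matrix.of w * B.map (algebraMap ℂ H) := by
    ext i j
    have := congr(tensorCoeff o i ($he (b j)))
    simp only [LinearMap.comp_apply, hx, map_sum, LinearMap.rTensor_tmul, LinearEquiv.coe_coe,
      tensorCoeff_tmul] at this
    rw [heB j] at this
    simp only [map_sum, map_smul, hσ, tensorCoeff_tmul, Module.Basis.repr_self,
      Finsupp.single_apply, ite_smul, one_smul, zero_smul, Finset.sum_ite_eq', Finset.mem_univ,
      if_true] at this
    simpa [Matrix.mul_apply, B, ← Algebra.commutes, ← Algebra.smul_def] using this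
  -- The standard inner product pulled back along the injective map `e`.
  refine ⟨Bᴴ * B, Matrix.PosDef.conjTranspose_mul_self _ ?_, ?_⟩
  · rw [← Matrix.coe_mulVecLin, injective_iff_map_eq_zero]
    intro y hy
    have h : e (∑ j, y j • b j) = 0 := by
      simp only [map_sum, map_smul, heB, Finset.smul_sum]
      rw [Finset.sum_comm]
      refine Finset.sum_eq_zero fun i _ => ?_
      have : ∑ j, B i j * y j = 0 := congrFun hy i
      simp only [smul_smul, ← Finset.sum_smul, mul_comm (y _), this, zero_smul]
    rw [LinearEquiv.map_eq_zero_iff] at h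
    exact funext (Fintype.linearIndependent_iff.mp b.linearIndependent y h)
  · have hw1 : (Matrix.of w)ᴴ * Matrix.of w = 1 := (Unitary.mem_iff.mp hw).1
    rw [Matrix.map_mul, ← map_algebraMap_conjTranspose]
    calc _ = (B.map (algebraMap ℂ H) * x)ᴴ * (B.map (algebraMap ℂ H) * x) := by
          simp only [Matrix.conjTranspose_mul, Matrix.mul_assoc]
      _ = (B.map (algebraMap ℂ H))ᴴ * ((Matrix.of w)ᴴ * Matrix.of w) * B.map (algebraMap ℂ H) := by
          rw [hBx]
          simp only [Matrix.conjTranspose_mul, Matrix.mul_assoc]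
      _ = _ := by rw [hw1, Matrix.mul_one]

/-- The matrix of a `*`-coaction on `ℂ^n` has self-adjoint entries. -/
theorem IsStarCoaction.star_apply {β : (Fin n → ℂ) →ₐ[ℂ] (Fin n → ℂ) ⊗[ℂ] H}
    (hβ : IsStarCoaction β) {x : Matrix (Fin n) (Fin n) H}
    (hx : ∀ i, β (Pi.single i 1) = ∑ k, Pi.single k 1 ⊗ₜ[ℂ] x k i) (k i : Fin n) :
    star (x k i) = x k i := by
  refine congrFun (sum_basis_tmul_injective (Pi.basisFun ℂ (Fin n)) (c := fun k => star (x k i))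
    (d := fun k => x k i) ?_) k
  have h := hβ.map_star (Pi.single i 1)
  rw [← Pi.single_star, star_one, hx] at h
  simp only [star_sum, TensorProduct.star_tmul, ← Pi.single_star, star_one] at h
  simpa only [Pi.basisFun_apply] using h.symm

/-- The matrix of a coaction on `ℂ^n` is a corepresentation. -/
theorem IsStarCoaction.isCorep {β : (Fin n → ℂ) →ₐ[ℂ] (Fin n → ℂ) ⊗[ℂ] H}
    (hβ : IsStarCoaction β) {x : Matrix (Fin n) (Fin n) H}
    (hx : ∀ i, β (Pi.single i 1) = ∑ k, Pi.single k 1 ⊗ₜ[ℂ] x k i) : IsCorep ℂ x :=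
  IsComodule.isCorep hβ.isCoaction (Pi.basisFun ℂ (Fin n)) fun j => by
    simpa only [Pi.basisFun_apply, AlgHom.toLinearMap_apply] using hx j

/-- The matrix of a coaction of a CQG algebra on `ℂ^n` is magic. -/
theorem IsStarCoaction.isMagic (hH : IsCQGAlgebra H) {β : (Fin n → ℂ) →ₐ[ℂ] (Fin n → ℂ) ⊗[ℂ] H}
    (hβ : IsStarCoaction β) {x : Matrix (Fin n) (Fin n) H}
    (hx : ∀ i, β (Pi.single i 1) = ∑ k, Pi.single k 1 ⊗ₜ[ℂ] x k i) : IsMagic x := by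
  let b := Pi.basisFun ℂ (Fin n)
  have hb : ∀ i, b i = Pi.single i 1 := Pi.basisFun_apply ℂ (Fin n)
  have hxb : ∀ j, β.toLinearMap (b j) = ∑ i, b i ⊗ₜ[ℂ] x i j := fun j => by
    simpa only [hb, AlgHom.toLinearMap_apply] using hx j
  obtain ⟨Q, hQ, hxQ⟩ := hH.exists_posDef b hβ.isCoaction hxb
  refine (hβ.isCorep hx).isMagic (fun i j => congrFun ?_) (congrFun ?_) (hβ.star_apply hx) hQ hxQ
  · refine sum_basis_tmul_injective b ?_
    have h := map_mul β (Pi.single i 1) (Pi.single j 1)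
    rw [QuantumPerm.single_mul_single] at h
    simp only [hx, Finset.sum_mul_sum, Algebra.TensorProduct.tmul_mul_tmul,
      QuantumPerm.single_mul_single, TensorProduct.ite_tmul, Finset.sum_ite_eq, Finset.mem_univ,
      if_true] at h
    simp only [hb, ← h]
    split_ifs <;> simp [hx]
  · refine sum_basis_tmul_injective b ?_
    have h := map_one β
    have h1 : (1 : Fin n → ℂ) = ∑ i, Pi.single i 1 :=
      (Finset.univ_sum_single (1 : Fin n → ℂ)).symm
    rw [Algebra.TensorProduct.one_def, h1, map_sum] at h
    simp only [hx, TensorProduct.sum_tmul] at h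
    rw [Finset.sum_comm] at h
    simpa only [hb, ← TensorProduct.tmul_sum] using h

end Coaction

/-! ### The universal property -/

namespace QuantumPerm

/-- A magic corepresentation gives a bialgebra map. -/
def liftBialgHom {K B : Type*} [Field K] [Ring B] [Bialgebra K B] {n : ℕ} {x : Fin n → Fin n → B}
    (hx : IsMagic x) (hc : IsCorep K (Matrix.of x)) : QuantumPerm K n →ₐc[K] B :=
  BialgHom.ofAlgHom (lift x hx)
    (algHom_ext fun i j => by simpa using hc.counit i j)
    (algHom_ext fun i j => by simpa using (hc.comul i j).symm)

@[simp]
theorem liftBialgHom_u {K B : Type*} [Field K] [Ring B] [Bialgebra K B] {n : ℕ}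
    {x : Fin n → Fin n → B} (hx : IsMagic x) (hc : IsCorep K (Matrix.of x)) (i j : Fin n) :
    liftBialgHom hx hc (u K n i j) = x i j :=
  lift_u x hx i j

end QuantumPerm

end

theorem theorem3p10 (n : ℕ) (hn : 1 ≤ n) :
    IsCQGAlgebra (QuantumPerm ℂ n) ∧
    IsStarCoaction (QuantumPerm.coaction ℂ n) ∧
    ∀ (H : Type*) [Ring H] [HopfAlgebra ℂ H] [StarRing H] [StarModule ℂ H],
      IsCQGAlgebra H →
      ∀ β : (Fin n → ℂ) →ₐ[ℂ] (Fin n → ℂ) ⊗[ℂ] H, IsStarCoaction β →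
        ∃ f : QuantumPerm ℂ n →ₐc[ℂ] H,
          (∀ a, f (star a) = star (f a)) ∧
          (Algebra.TensorProduct.map (AlgHom.id ℂ (Fin n → ℂ)) (f : QuantumPerm ℂ n →ₐ[ℂ] H)).comp
            (QuantumPerm.coaction ℂ n) = β ∧
          ∀ g : QuantumPerm ℂ n →ₐc[ℂ] H,
            (Algebra.TensorProduct.map (AlgHom.id ℂ (Fin n → ℂ))
              (g : QuantumPerm ℂ n →ₐ[ℂ] H)).comp (QuantumPerm.coaction ℂ n) = β → g = f := by
  refine ⟨QuantumPerm.isCQGAlgebra n, QuantumPerm.isStarCoaction_coaction n, ?_⟩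
  intro H _ _ _ _ hH β hβ
  let b := Pi.basisFun ℂ (Fin n)
  have hb : ∀ i, b i = Pi.single i 1 := Pi.basisFun_apply ℂ (Fin n)
  let x : Matrix (Fin n) (Fin n) H := .of fun k i => tensorCoeff b k (β (Pi.single i 1))
  have hx : ∀ i, β (Pi.single i 1) = ∑ k, Pi.single k 1 ⊗ₜ[ℂ] x k i := fun i => by
    simpa only [hb, x, Matrix.of_apply] using (sum_tmul_tensorCoeff b (β (Pi.single i 1))).symm
  have hmagic : IsMagic x := hβ.isMagic hH hx
  have hcor : IsCorep ℂ x := hβ.isCorep hx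
  have hstar := hβ.star_apply hx
  obtain ⟨f, hf⟩ : ∃ f : QuantumPerm ℂ n →ₐc[ℂ] H, ∀ k i, f (QuantumPerm.u ℂ n k i) = x k i :=
    ⟨QuantumPerm.liftBialgHom hmagic hcor, QuantumPerm.liftBialgHom_u hmagic hcor⟩
  refine ⟨f, fun a => ?_, ?_, fun g hg => ?_⟩
  -- Both sides are conjugate linear and antimultiplicative, so self-adjointness of the `x i j`
  -- suffices.
  · induction a using QuantumPerm.induction with
    | hu i j => simp [hf, hstar]
    | hK c => simp only [← algebraMap_star_comm, AlgHomClass.commutes]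
    | hadd a b ha hb => simp only [star_add, map_add, ha, hb]
    | hmul a b ha hb => simp only [star_mul, map_mul, ha, hb]
  · refine AlgHom.toLinearMap_injective (b.ext fun i => ?_)
    simp [hb, hf, hx]
  -- Comparing coefficients in `ℂ^n ⊗ H` determines `g` on the generators.
  · have hgx : ∀ k i, g (QuantumPerm.u ℂ n k i) = x k i := fun k i => by
      have h := congr(tensorCoeff b k ($hg (Pi.single i 1)))
      rw [hx] at h
      simpa [b, Pi.single_apply] using h
    have : (g : QuantumPerm ℂ n →ₐ[ℂ] H) = f :=
      QuantumPerm.algHom_ext fun i j => by simp [hgx, hf]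
    exact BialgHom.ext fun a => congr($this a)
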